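/- Let $N\ge 4$ be an integer, let $q>1$ and $\lambda\in\mathbb R$, and put $q_3=\frac{N+1}{N-3}$. Let $S^{N-1}_+=\{\sigma\in\mathbb R^N:|\sigma|=1,\ \sigma_1>0\}$ be the open half-sphere, with boundary $\partial S^{N-1}_+=\{|\sigma|=1,\ \sigma_1=0\}$. Let $\nabla'$ and $\Delta'$ be the gradient and the Laplace–Beltrami operator of the unit sphere $S^{N-1}$, let $d\sigma$ and $d\tau$ be the surface measures of $S^{N-1}$ and of $\partial S^{N-1}_+$, and let $\phi(\sigma)=\sigma_1$. Let $v$ be a real-valued classical solution, of class $C^2$ in $S^{N-1}_+$ and of class $C^1$ up to the boundary, of $$-\Delta' v=\lambda v+v^q\ \text{ in } S^{N-1}_+,\qquad v=0\ \text{ on }\partial S^{N-1}_+ .$$ (The power $v^q$ has its usual meaning where $v\ge 0$, and for all real values of $v$ if $q$ is an integer. No sign of $v$ is assumed: if $q$ is not an integer, then at points where $v<0$ read $v^q$ as $|v|^q\cos(\pi q)$.) Then $$\frac{N-3}{q+1}\,(q-q_3)\int_{S^{N-1}_+}|\nabla' v|^2\,\phi\,d\sigma-\frac{(N-1)(q-1)}{q+1}\Bigl(\lambda+\frac{N-1}{q-1}\Bigr)\int_{S^{N-1}_+}v^2\,\phi\,d\sigma=-\int_{\partial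 S^{N-1}_+}|\nabla' v|^2\,d\tau .$$ -/

import Mathlib

open MeasureTheory

noncomputable section

/-- The open half-space `{x ∈ ℝ^N : x₁ > 0}` (the first coordinate has index `0`). -/
def openHalfSpace (N : ℕ) [NeZero N] : Set (EuclideanSpace ℝ (Fin N)) :=
  {x | 0 < x 0}

/-- The closed half-space without the origin, `{x ∈ ℝ^N : x₁ ≥ 0, x ≠ 0}`. -/
def closedHalfSpace (N : ℕ) [NeZero N] : Set (EuclideanSpace ℝ (Fin N)) :=
  {x | 0 ≤ x 0 ∧ x ≠ 0}

/-- The hyperplane `{x ∈ ℝ^N : x₁ = 0}`, an `(N-1)`-dimensional Euclidean space. Its unit sphere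
is the boundary of the half-sphere. -/
def boundaryHyperplane (N : ℕ) [NeZero N] : Submodule ℝ (EuclideanSpace ℝ (Fin N)) where
  carrier := {x | x 0 = 0}
  add_mem' := by
    intro x y hx hy
    simp_all
  zero_mem' := by simp
  smul_mem' := by
    intro c x hx
    simp_all

/-- The extension of a function on the (half-)sphere that is constant along rays. -/
def radialExtension {N : ℕ} (v : EuclideanSpace ℝ (Fin N) → ℝ) :
    EuclideanSpace ℝ (Fin N) → ℝ :=
  fun x => v (‖x‖⁻¹ • x)

/-- The gradient `∇'v` on the sphere, at a point `σ` of the closed half-sphere: the Euclidean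
gradient at `σ` of the extension of `v` that is constant along rays. At a boundary point it is the
derivative from within the closed half-space. -/
def sphericalGradient {N : ℕ} [NeZero N] (v : EuclideanSpace ℝ (Fin N) → ℝ)
    (σ : EuclideanSpace ℝ (Fin N)) : EuclideanSpace ℝ (Fin N) :=
  gradientWithin (radialExtension v) (closedHalfSpace N) σ

/-- The Laplace-Beltrami operator `Δ'v` of the unit sphere, at an interior point `σ` of the
half-sphere: the Euclidean Laplacian at `σ` of the extension of `v` that is constant along rays. -/
def sphericalLaplacian {N : ℕ} (v : EuclideanSpace ℝ (Fin N) → ℝ)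
    (σ : EuclideanSpace ℝ (Fin N)) : ℝ :=
  Laplacian.laplacian (radialExtension v) σ

/-- `v` is a classical solution of `-Δ'v = lam * v + v ^ q` in the open half-sphere
`{‖σ‖ = 1, σ₁ > 0}`, with `v = 0` on its boundary `{‖σ‖ = 1, σ₁ = 0}`. It is `C²` inside and `C¹`
up to the boundary. Only the values of `v` on the closed half-sphere matter. -/
structure IsHalfSphereSolution (N : ℕ) [NeZero N] (lam q : ℝ)
    (v : EuclideanSpace ℝ (Fin N) → ℝ) : Prop where
  contDiff_inside : ContDiffOn ℝ 2 (radialExtension v) (openHalfSpace N)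
  contDiff_upToBoundary : ContDiffOn ℝ 1 (radialExtension v) (closedHalfSpace N)
  equation : ∀ σ : EuclideanSpace ℝ (Fin N), ‖σ‖ = 1 → 0 < σ 0 →
    -sphericalLaplacian v σ = lam * v σ + v σ ^ q
  boundary : ∀ σ : EuclideanSpace ℝ (Fin N), ‖σ‖ = 1 → σ 0 = 0 → v σ = 0

/-- The integral `∫_{S^{N-1}_+} f dσ` with respect to the surface measure of the unit sphere. -/
def integralHalfSphere (N : ℕ) [NeZero N] (f : EuclideanSpace ℝ (Fin N) → ℝ) : ℝ :=
  ∫ σ in {σ : Metric.sphere (0 : EuclideanSpace ℝ (Fin N)) 1 |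
      0 < (σ : EuclideanSpace ℝ (Fin N)) 0},
    f σ ∂(volume : Measure (EuclideanSpace ℝ (Fin N))).toSphere

/-- The integral `∫_{∂S^{N-1}_+} f dτ` with respect to the surface measure of the boundary, the
unit sphere of the hyperplane `{x₁ = 0}`. -/
def integralHalfSphereBoundary (N : ℕ) [NeZero N] (f : EuclideanSpace ℝ (Fin N) → ℝ) : ℝ :=
  ∫ τ : Metric.sphere (0 : boundaryHyperplane N) 1,
    f ((τ : boundaryHyperplane N) : EuclideanSpace ℝ (Fin N))
      ∂(volume : Measure (boundaryHyperplane N)).toSphere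

/-- The critical exponent `q₃ = (N + 1) / (N - 3)`. -/
def criticalExponentThree (N : ℕ) : ℝ := ((N : ℝ) + 1) / ((N : ℝ) - 3)

end

/-! Write `φ` for the first coordinate and `f = λv + v^q`, with primitive `F` vanishing at `0`. On
the sphere `Hess φ = -φ g`, hence `Δ'φ = -(N-1)φ`. The theorem combines two divergence identities.

Pohozaev: the field `⟨∇'φ,∇'v⟩∇'v + (F(v) - |∇'v|²/2)∇'φ` has divergence `φ((N-3)/2 |∇'v|² -
(N-1)F(v))` (`divergence_pohozaevField`). On the boundary `v = 0` and `∇'v` is normal, so its flux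
there is half the integral of `|∇'v|²`.

Energy: the field `φv∇'v - v²∇'φ/2` has divergence `φ(|∇'v|² - v f + (N-1)/2 v²)`
(`divergence_energyField`), and no flux since `v = 0` on the boundary. Eliminating the integral of
`v · v^q φ` between the two gives the claim.

Although `v` is only `C¹` up to the boundary, no approximation is needed: the equation removes all
second derivatives from both divergences, so these extend continuously to the boundary.

No calculus on manifolds is used. Both fields are extended to the half-space as tangential fields of
degree two, multiplied by a radial cutoff, and fed to the divergence theorem on a box. In polar
coordinates both sides carry the same positive radial integral, which cancels
(`integralHalfSphere_divergence`). -/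

open MeasureTheory

noncomputable section

/-! ### Polar coordinates and the boundary hyperplane. -/

/-- Polar coordinates for a product of a function of the direction and a function of the radius. -/
theorem integral_direction_mul_radial {E : Type*} [NormedAddCommGroup E] [NormedSpace ℝ E]
    [FiniteDimensional ℝ E] [Nontrivial E] [MeasurableSpace E] [BorelSpace E]
    (μ : Measure E) [μ.IsAddHaarMeasure] (p : E → ℝ) (η : ℝ → ℝ) :
    ∫ x, p (‖x‖⁻¹ • x) * η ‖x‖ ∂μ =
      (∫ σ : Metric.sphere (0 : E) 1, p σ ∂μ.toSphere) *
        ∫ r in Set.Ioi (0 : ℝ), r ^ (Module.finrank ℝ E - 1) * η r :=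
  calc
    ∫ x, p (‖x‖⁻¹ • x) * η ‖x‖ ∂μ
      = ∫ x : ({(0)}ᶜ : Set E), p (‖x.1‖⁻¹ • x.1) * η ‖x.1‖ ∂(μ.comap (↑)) := by
      rw [integral_subtype_comap (measurableSet_singleton _).compl
        fun x ↦ p (‖x‖⁻¹ • x) * η ‖x‖, restrict_compl_singleton]
    _ = ∫ x : Metric.sphere (0 : E) 1 × Set.Ioi (0 : ℝ), p x.1 * η x.2
          ∂μ.toSphere.prod (.volumeIoiPow (Module.finrank ℝ E - 1)) := by
      simpa using μ.measurePreserving_homeomorphUnitSphereProd.integral_comp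
        (Homeomorph.measurableEmbedding _)
        (fun x : Metric.sphere (0 : E) 1 × Set.Ioi (0 : ℝ) ↦ p x.1 * η x.2)
    _ = (∫ σ : Metric.sphere (0 : E) 1, p σ ∂μ.toSphere) *
          ∫ x : Set.Ioi (0 : ℝ), η x ∂.volumeIoiPow (Module.finrank ℝ E - 1) :=
      integral_prod_mul (fun σ : Metric.sphere (0 : E) 1 ↦ p σ) (fun x : Set.Ioi (0 : ℝ) ↦ η x)
    _ = _ := by
      congr 1
      simp only [Measure.volumeIoiPow, ENNReal.ofReal]
      rw [integral_withDensity_eq_integral_smul,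
        integral_subtype_comap measurableSet_Ioi
          fun a ↦ Real.toNNReal (a ^ (Module.finrank ℝ E - 1)) • η a,
        setIntegral_congr_fun measurableSet_Ioi fun x hx ↦ ?_]
      · rw [NNReal.smul_def, Real.coe_toNNReal _ (pow_nonneg (Set.mem_Ioi.1 hx).le _), smul_eq_mul]
      · exact (measurable_subtype_coe.pow_const _).real_toNNReal

/-- The parametrization of the hyperplane `{x₁ = 0}` by the remaining coordinates. -/
def hyperplaneParametrization (n : ℕ) :
    EuclideanSpace ℝ (Fin n) ≃ₗᵢ[ℝ] boundaryHyperplane (n + 1) where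
  toFun z := ⟨WithLp.toLp 2 (Fin.cons 0 z), rfl⟩
  invFun x := WithLp.toLp 2 fun i ↦ (x : EuclideanSpace ℝ (Fin (n + 1))) i.succ
  map_add' x y := by
    ext i
    refine Fin.cases ?_ (fun j ↦ ?_) i <;> simp
  map_smul' c x := by
    ext i
    refine Fin.cases ?_ (fun j ↦ ?_) i <;> simp
  left_inv x := by
    ext i
    simp
  right_inv x := by
    obtain ⟨x, hx⟩ := x
    ext i
    refine Fin.cases ?_ (fun j ↦ ?_) i
    · simpa using hx.symm
    · simp
  norm_map' x := by
    simp [EuclideanSpace.norm_eq, Fin.sum_univ_succ]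

theorem integral_boundaryHyperplane (n : ℕ) (f : EuclideanSpace ℝ (Fin (n + 1)) → ℝ) :
    ∫ y : boundaryHyperplane (n + 1), f y = ∫ z : Fin n → ℝ, f (WithLp.toLp 2 (Fin.cons 0 z)) := by
  rw [← (hyperplaneParametrization n).measurePreserving.integral_comp
    (hyperplaneParametrization n).toHomeomorph.measurableEmbedding,
    ← (PiLp.volume_preserving_toLp (Fin n)).integral_comp
      (MeasurableEquiv.toLp 2 (Fin n → ℝ)).measurableEmbedding]
  rfl

theorem finrank_boundaryHyperplane (n : ℕ) :
    Module.finrank ℝ (boundaryHyperplane (n + 1)) = n := by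
  rw [← (hyperplaneParametrization n).toLinearEquiv.finrank_eq]
  simp

theorem volume_coordinate_eq_zero (n : ℕ) :
    (volume : Measure (Fin (n + 1) → ℝ)) {x | x 0 = 0} = 0 :=
  Measure.pi_hyperplane (fun _ : Fin (n + 1) ↦ (volume : Measure ℝ)) 0 0

/-! ### Divergence theorems on the half-space and the half-sphere. -/

/-- The divergence theorem in a half-space for a compactly supported vector field. -/
theorem integral_divergence_openHalfSpace (n : ℕ)
    (X : EuclideanSpace ℝ (Fin (n + 1)) → EuclideanSpace ℝ (Fin (n + 1)))
    (D : EuclideanSpace ℝ (Fin (n + 1)) → ℝ) (R : ℝ) (hR : 0 < R)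
    (hX : ∀ x, R ≤ ‖x‖ → X x = 0) (hD : ∀ x, R ≤ ‖x‖ → D x = 0)
    (hXc : ContinuousOn X {x | 0 ≤ x 0}) (hDc : ContinuousOn D {x | 0 ≤ x 0})
    (hXd : ∀ x ∈ openHalfSpace (n + 1), DifferentiableAt ℝ X x)
    (hdiv : ∀ x ∈ openHalfSpace (n + 1),
      LinearMap.trace ℝ _ (fderiv ℝ X x : EuclideanSpace ℝ (Fin (n + 1)) →ₗ[ℝ] _) = D x) :
    ∫ x in openHalfSpace (n + 1), D x = -∫ y : boundaryHyperplane (n + 1), X y 0 := by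
  -- The box is `[0, R] × [-R, R]^n`. All its faces except `x₁ = 0` lie where `‖x‖ ≥ R`, so only
  -- that face contributes.
  set a : Fin (n + 1) → ℝ := Fin.cons 0 fun _ ↦ -R with ha
  set b : Fin (n + 1) → ℝ := fun _ ↦ R with hb
  have hab : a ≤ b := by
    intro i
    refine Fin.cases ?_ (fun j ↦ ?_) i
    · simpa [ha, hb] using hR.le
    · simp only [ha, hb, Fin.cons_succ]; linarith
  have hnorm : ∀ (x : EuclideanSpace ℝ (Fin (n + 1))) i, |x i| ≤ ‖x‖ := fun x i ↦ by
    simpa using PiLp.norm_apply_le x i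
  set L := (EuclideanSpace.equiv (Fin (n + 1)) ℝ) with hL
  have hmem : ∀ x ∈ Set.Icc a b, WithLp.toLp 2 x ∈
      {x : EuclideanSpace ℝ (Fin (n + 1)) | 0 ≤ x 0} := fun x hx ↦ by
    simpa [ha] using hx.1 0
  have hcont : ContinuousOn (fun x : Fin (n + 1) → ℝ ↦ (WithLp.toLp 2 x :
      EuclideanSpace ℝ (Fin (n + 1)))) (Set.Icc a b) := L.symm.continuous.continuousOn
  set f' : (Fin (n + 1) → ℝ) → (Fin (n + 1) → ℝ) →L[ℝ] (Fin (n + 1) → ℝ) := fun x ↦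
    (L : _ →L[ℝ] _) ∘L fderiv ℝ X (WithLp.toLp 2 x) ∘L (L.symm : _ →L[ℝ] _) with hf'
  have htrace : ∀ x, ∑ i, f' x (Pi.single i 1) i =
      LinearMap.trace ℝ _ (fderiv ℝ X (WithLp.toLp 2 x) :
        EuclideanSpace ℝ (Fin (n + 1)) →ₗ[ℝ] _) := fun x ↦ by
    rw [LinearMap.trace_eq_sum_inner _ (EuclideanSpace.basisFun (Fin (n + 1)) ℝ)]
    refine Finset.sum_congr rfl fun i _ ↦ ?_
    rw [EuclideanSpace.basisFun_apply, EuclideanSpace.inner_single_left]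
    simp [hf', hL]
  have hae : (fun x ↦ ∑ i, f' x (Pi.single i 1) i) =ᵐ[volume.restrict (Set.Icc a b)]
      fun x ↦ D (WithLp.toLp 2 x) := by
    rw [Filter.EventuallyEq, ae_restrict_iff' measurableSet_Icc]
    -- On the face `x₁ = 0` nothing relates `fderiv ℝ X` to `D`, but that face is null.
    have h0 : ∀ᵐ x : Fin (n + 1) → ℝ, x 0 ≠ 0 := by
      rw [ae_iff]
      simpa using volume_coordinate_eq_zero n
    filter_upwards [h0] with x hx0 hx
    rw [htrace]
    exact hdiv _ (lt_of_le_of_ne (hmem x hx) (Ne.symm hx0))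
  have hint : IntegrableOn (fun x ↦ D (WithLp.toLp 2 x)) (Set.Icc a b) :=
    (hDc.comp hcont hmem).integrableOn_compact isCompact_Icc
  have key := integral_divergence_of_hasFDerivAt_off_countable a b hab
    (fun x ↦ WithLp.ofLp (X (WithLp.toLp 2 x))) f' ∅ Set.countable_empty
    (L.continuous.comp_continuousOn (hXc.comp hcont hmem)) ?_ (hint.congr hae.symm)
  · rw [integral_congr_ae hae, Fin.sum_univ_succ] at key
    have hfront : ∀ (i : Fin (n + 1)) (z : Fin n → ℝ),
        X (WithLp.toLp 2 (i.insertNth (b i) z)) = 0 := fun i z ↦ hX _ <| by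
      refine le_trans ?_ (hnorm _ i)
      simp [hb, abs_of_pos hR]
    have hback : ∀ (i : Fin n) (z : Fin n → ℝ),
        X (WithLp.toLp 2 (i.succ.insertNth (a i.succ) z)) = 0 := fun i z ↦ hX _ <| by
      refine le_trans ?_ (hnorm _ i.succ)
      simp [ha, abs_of_pos hR]
    simp only [hfront, hback] at key
    simp only [WithLp.ofLp_zero, Pi.zero_apply, integral_zero, sub_zero, Finset.sum_const_zero,
      add_zero, zero_sub] at key
    have hleft : ∫ x in openHalfSpace (n + 1), D x = ∫ x in Set.Icc a b, D (WithLp.toLp 2 x) := by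
      have hm : MeasurableSet (openHalfSpace (n + 1)) :=
        (isOpen_lt continuous_const (EuclideanSpace.proj (𝕜 := ℝ) 0).continuous).measurableSet
      rw [← integral_indicator hm, ← integral_indicator measurableSet_Icc,
        ← (PiLp.volume_preserving_toLp (Fin (n + 1))).integral_comp
          (MeasurableEquiv.toLp 2 (Fin (n + 1) → ℝ)).measurableEmbedding]
      have h0 : ∀ᵐ x : Fin (n + 1) → ℝ, x 0 ≠ 0 := by
        rw [ae_iff]
        simpa using volume_coordinate_eq_zero n
      refine integral_congr_ae ?_
      filter_upwards [h0] with x hx0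
      by_cases hx : R ≤ ‖(WithLp.toLp 2 x : EuclideanSpace ℝ (Fin (n + 1)))‖
      · simp [Set.indicator, hD _ hx]
      have hxi : ∀ i, |x i| ≤ R := fun i ↦ (hnorm (WithLp.toLp 2 x) i).trans (not_le.1 hx).le
      have : x ∈ Set.Icc a b ↔ WithLp.toLp 2 x ∈ openHalfSpace (n + 1) := by
        refine ⟨fun h ↦ lt_of_le_of_ne (hmem x h) (Ne.symm hx0), fun h ↦ ⟨fun i ↦ ?_, fun i ↦ ?_⟩⟩
        · refine Fin.cases ?_ (fun j ↦ ?_) i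
          · exact le_of_lt h
          · simpa [ha] using (abs_le.1 (hxi j.succ)).1
        · exact (abs_le.1 (hxi i)).2
      by_cases h : x ∈ Set.Icc a b
      · rw [Set.indicator_of_mem h, Set.indicator_of_mem (this.1 h)]
      · rw [Set.indicator_of_notMem h, Set.indicator_of_notMem (mt this.2 h)]
    rw [hleft, key, integral_boundaryHyperplane n fun y ↦ X y 0]
    congr 1
    rw [← integral_indicator measurableSet_Icc]
    congr 1
    ext z
    by_cases hz : z ∈ Set.Icc (a ∘ Fin.succAbove 0) (b ∘ Fin.succAbove 0)
    · rw [Set.indicator_of_mem hz]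
      simp [ha]
    · rw [Set.indicator_of_notMem hz, hX _ ?_]
      · simp
      by_contra! hlt
      refine hz ⟨fun i ↦ ?_, fun i ↦ ?_⟩
      · have := (abs_le.1 ((hnorm _ i.succ).trans hlt.le)).1
        simpa [ha] using this
      · have := (abs_le.1 ((hnorm _ i.succ).trans hlt.le)).2
        simpa [hb] using this
  · rintro x ⟨hx, -⟩
    have h0 : WithLp.toLp 2 x ∈ openHalfSpace (n + 1) := by
      simpa [ha, openHalfSpace] using (hx 0 (Set.mem_univ _)).1
    exact L.hasFDerivAt.comp x ((hXd _ h0).hasFDerivAt.comp x L.symm.hasFDerivAt)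

theorem isOpen_openHalfSpace (N : ℕ) [NeZero N] : IsOpen (openHalfSpace N) :=
  isOpen_lt continuous_const (EuclideanSpace.proj (𝕜 := ℝ) (0 : Fin N)).continuous

theorem openHalfSpace_subset_closedHalfSpace (N : ℕ) [NeZero N] :
    openHalfSpace N ⊆ closedHalfSpace N := fun x hx ↦
  ⟨le_of_lt hx, fun h ↦ by simp [openHalfSpace, h] at hx⟩

theorem smul_mem_openHalfSpace {N : ℕ} [NeZero N] {x : EuclideanSpace ℝ (Fin N)}
    (hx : x ∈ openHalfSpace N) {c : ℝ} (hc : 0 < c) : c • x ∈ openHalfSpace N := by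
  simpa [openHalfSpace] using mul_pos hc hx

theorem smul_mem_closedHalfSpace {N : ℕ} [NeZero N] {x : EuclideanSpace ℝ (Fin N)}
    (hx : x ∈ closedHalfSpace N) {c : ℝ} (hc : 0 < c) : c • x ∈ closedHalfSpace N :=
  ⟨by simpa using mul_nonneg hc.le hx.1, by simpa using ⟨hc.ne', hx.2⟩⟩

theorem uniqueDiffOn_closedHalfSpace (N : ℕ) [NeZero N] :
    UniqueDiffOn ℝ (closedHalfSpace N) := by
  have h : UniqueDiffOn ℝ {x : EuclideanSpace ℝ (Fin N) | 0 ≤ x 0} := by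
    refine uniqueDiffOn_convex ?_ ⟨EuclideanSpace.single 0 1, ?_⟩
    · exact convex_halfSpace_ge (EuclideanSpace.proj (𝕜 := ℝ) (0 : Fin N)).isLinear 0
    · have hsub : openHalfSpace N ⊆ {x | 0 ≤ x 0} := fun x (hx : 0 < x 0) ↦
        (hx.le : 0 ≤ x 0)
      refine interior_maximal hsub (isOpen_openHalfSpace N) ?_
      simp [openHalfSpace]
  exact h.inter isOpen_compl_singleton

/-- Homogeneous extensions may be singular at the origin; a cutoff vanishing near it restores
continuity on the full closed half-space. -/
theorem continuousOn_cutoff_smul {N : ℕ} [NeZero N] {F : Type*} [NormedAddCommGroup F]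
    [NormedSpace ℝ F] {η : ℝ → ℝ} (hη : Continuous η) (hη0 : ∀ r < 1, η r = 0)
    {h : EuclideanSpace ℝ (Fin N) → F} (hh : ContinuousOn h (closedHalfSpace N)) :
    ContinuousOn (fun x ↦ η (‖x‖ ^ 2) • h x) {x | 0 ≤ x 0} := by
  intro x hx
  by_cases hx0 : x = 0
  · have : (fun x ↦ η (‖x‖ ^ 2) • h x) =ᶠ[nhds x] fun _ ↦ 0 := by
      have h1 : ∀ᶠ y : EuclideanSpace ℝ (Fin N) in nhds x, ‖y‖ ^ 2 < 1 :=
        (continuous_norm.pow 2).continuousAt.eventually_lt_const (by simp [hx0])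
      filter_upwards [h1] with y hy
      simp [hη0 _ hy]
    exact (continuousAt_const.congr this.symm).continuousWithinAt
  · refine ((hη.comp (continuous_norm.pow 2)).continuousWithinAt).smul ?_
    refine (hh x ⟨hx, hx0⟩).mono_of_mem_nhdsWithin ?_
    exact inter_mem_nhdsWithin _ (isOpen_compl_singleton.mem_nhds hx0)

/-- The divergence theorem on the half-sphere for a tangential vector field, given as a
vector field on the half-space that is homogeneous of degree two. -/
theorem integralHalfSphere_divergence (n : ℕ) (hn : n ≠ 0)
    (Y : EuclideanSpace ℝ (Fin (n + 1)) → EuclideanSpace ℝ (Fin (n + 1)))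
    (g : EuclideanSpace ℝ (Fin (n + 1)) → ℝ)
    (hYc : ContinuousOn Y (closedHalfSpace (n + 1)))
    (hYh : ∀ c : ℝ, 0 < c → ∀ x ∈ closedHalfSpace (n + 1), Y (c • x) = c ^ 2 • Y x)
    (hYd : ∀ x ∈ openHalfSpace (n + 1), DifferentiableAt ℝ Y x)
    (hYt : ∀ x ∈ openHalfSpace (n + 1), inner ℝ x (Y x) = 0)
    (hg : ContinuousOn g (closedHalfSpace (n + 1)))
    (hdiv : ∀ x ∈ openHalfSpace (n + 1), ‖x‖ = 1 →
      LinearMap.trace ℝ _ (fderiv ℝ Y x : EuclideanSpace ℝ (Fin (n + 1)) →ₗ[ℝ] _) = g x) :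
    integralHalfSphere (n + 1) g = -integralHalfSphereBoundary (n + 1) fun τ ↦ Y τ 0 := by
  have hopen := isOpen_openHalfSpace (n + 1)
  -- `ψ` is positive exactly on `(1, 3)`. Evaluated at `‖x‖²`, it is smooth in `x` and vanishes near
  -- `0` and for `‖x‖ ≥ 2`.
  let ψ : ContDiffBump (2 : ℝ) := ⟨1 / 2, 1, by norm_num, by norm_num⟩
  have hψ0 : ∀ r < 1, ψ r = 0 := fun r hr ↦ ψ.zero_of_le_dist <| by
    rw [Real.dist_eq, abs_of_neg (by linarith)]; simp only [ψ]; linarith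
  have hψ3 : ∀ r, 3 ≤ r → ψ r = 0 := fun r hr ↦ ψ.zero_of_le_dist <| by
    rw [Real.dist_eq, abs_of_nonneg (by linarith)]; simp only [ψ]; linarith
  have hψd : Differentiable ℝ ψ := (ψ.contDiff (n := 1)).differentiable (by norm_num)
  have hR : ∀ x : EuclideanSpace ℝ (Fin (n + 1)), 2 ≤ ‖x‖ → ψ (‖x‖ ^ 2) = 0 := fun x hx ↦
    hψ3 _ (by nlinarith)
  have hnpos : ∀ x ∈ closedHalfSpace (n + 1), 0 < ‖x‖ := fun x hx ↦ norm_pos_iff.2 hx.2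
  -- The derivative of a field of degree two has degree one, so its trace is determined by its
  -- values on the unit sphere.
  have hdiv' : ∀ x ∈ openHalfSpace (n + 1),
      LinearMap.trace ℝ _ (fderiv ℝ Y x : EuclideanSpace ℝ (Fin (n + 1)) →ₗ[ℝ] _) =
        ‖x‖ * g (‖x‖⁻¹ • x) := by
    intro x hx
    have hxc := openHalfSpace_subset_closedHalfSpace _ hx
    have hpos := hnpos x hxc
    set c := ‖x‖⁻¹ with hc
    have hcpos : 0 < c := inv_pos.2 hpos
    have h1 : fderiv ℝ (fun y ↦ Y (c • y)) x = c • fderiv ℝ Y (c • x) := fderiv_comp_smul c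
    have h2 : fderiv ℝ (fun y ↦ Y (c • y)) x = c ^ 2 • fderiv ℝ Y x := by
      rw [← fderiv_const_smul (hYd x hx)]
      refine Filter.EventuallyEq.fderiv_eq ?_
      filter_upwards [hopen.mem_nhds hx] with y hy
      exact hYh c hcpos y (openHalfSpace_subset_closedHalfSpace _ hy)
    have h3 : fderiv ℝ Y x = ‖x‖ • fderiv ℝ Y (c • x) := by
      have h4 : c • fderiv ℝ Y x = fderiv ℝ Y (c • x) := by
        refine smul_right_injective _ hcpos.ne' ?_
        simp only
        rw [← h1, h2, smul_smul, sq]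
      rw [← h4, smul_smul, hc, mul_inv_cancel₀ hpos.ne', one_smul]
    rw [h3, ContinuousLinearMap.toLinearMap_smul, map_smul, hdiv _ (smul_mem_openHalfSpace hx hcpos)
      (by rw [norm_smul, hc, norm_inv, norm_norm, inv_mul_cancel₀ hpos.ne']), smul_eq_mul]
  have hgc : ContinuousOn (fun x ↦ ‖x‖ * g (‖x‖⁻¹ • x)) (closedHalfSpace (n + 1)) := by
    refine continuous_norm.continuousOn.mul (hg.comp ?_ fun x hx ↦
      smul_mem_closedHalfSpace hx (inv_pos.2 (hnpos x hx)))
    exact (continuous_norm.continuousOn.inv₀ fun x hx ↦ (hnpos x hx).ne').smul continuousOn_id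
  have hXderiv : ∀ x ∈ openHalfSpace (n + 1), HasFDerivAt (fun x ↦ ψ (‖x‖ ^ 2) • Y x)
      (ψ (‖x‖ ^ 2) • fderiv ℝ Y x +
        (deriv ψ (‖x‖ ^ 2) • (2 : ℕ) • innerSL ℝ x).smulRight (Y x)) x := fun x hx ↦
    HasFDerivAt.smul ((hψd _).hasDerivAt.comp_hasFDerivAt x
      (hasStrictFDerivAt_norm_sq x).hasFDerivAt) (hYd x hx).hasFDerivAt
  have key := integral_divergence_openHalfSpace n (fun x ↦ ψ (‖x‖ ^ 2) • Y x)
    (fun x ↦ ψ (‖x‖ ^ 2) • (‖x‖ * g (‖x‖⁻¹ • x))) 2 two_pos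
    (fun x hx ↦ by simp [hR x hx]) (fun x hx ↦ by simp [hR x hx])
    (continuousOn_cutoff_smul ψ.continuous hψ0 hYc)
    (continuousOn_cutoff_smul ψ.continuous hψ0 hgc)
    (fun x hx ↦ (hXderiv x hx).differentiableAt) (fun x hx ↦ by
      rw [(hXderiv x hx).fderiv, ContinuousLinearMap.toLinearMap_add,
        ContinuousLinearMap.toLinearMap_smul, map_add, map_smul, hdiv' x hx]
      -- The gradient of the cutoff is radial and `Y` is tangential, so the cutoff adds nothing to
      -- the divergence.
      have : LinearMap.trace ℝ (EuclideanSpace ℝ (Fin (n + 1)))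
          ((deriv ψ (‖x‖ ^ 2) • (2 : ℕ) • innerSL ℝ x).smulRight (Y x) :
            EuclideanSpace ℝ (Fin (n + 1)) →L[ℝ] _) = 0 := by
        refine (LinearMap.trace_smulRight
          ((deriv ψ (‖x‖ ^ 2) • (2 : ℕ) • innerSL ℝ x : _ →L[ℝ] ℝ) : _ →ₗ[ℝ] ℝ) (Y x)).trans ?_
        simp [hYt x hx]
      rw [this, add_zero])
  have hleft : ∫ x in openHalfSpace (n + 1), ψ (‖x‖ ^ 2) • (‖x‖ * g (‖x‖⁻¹ • x)) =
      integralHalfSphere (n + 1) g * ∫ r in Set.Ioi (0 : ℝ), r ^ (n + 1) * ψ (r ^ 2) := by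
    have hm : MeasurableSet {σ : Metric.sphere (0 : EuclideanSpace ℝ (Fin (n + 1))) 1 |
        0 < (σ : EuclideanSpace ℝ (Fin (n + 1))) 0} :=
      (hopen.preimage continuous_subtype_val).measurableSet
    have := integral_direction_mul_radial (volume : Measure (EuclideanSpace ℝ (Fin (n + 1))))
      ((openHalfSpace (n + 1)).indicator g) fun r ↦ r * ψ (r ^ 2)
    rw [integralHalfSphere, ← integral_indicator hm, ← integral_indicator hopen.measurableSet]
    refine Eq.trans ?_ (this.trans ?_)
    · congr 1
      ext x
      by_cases hx : x ∈ openHalfSpace (n + 1)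
      · rw [Set.indicator_of_mem hx, Set.indicator_of_mem (smul_mem_openHalfSpace hx
          (inv_pos.2 (hnpos x (openHalfSpace_subset_closedHalfSpace _ hx)))), smul_eq_mul]
        ring
      · rw [Set.indicator_of_notMem hx, Set.indicator_of_notMem, zero_mul]
        intro h
        rcases eq_or_ne x 0 with rfl | h0
        · simp [openHalfSpace] at h
        · have := smul_mem_openHalfSpace h (norm_pos_iff.2 h0)
          rw [smul_smul, mul_inv_cancel₀ (norm_ne_zero_iff.2 h0), one_smul] at this
          exact hx this
    · congr 1
      refine integral_congr_ae (Filter.Eventually.of_forall fun r ↦ ?_)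
      simp only [finrank_euclideanSpace, Fintype.card_fin, Nat.add_sub_cancel]
      ring
  -- The hyperplane has volume weight `r^(n-1)` and `Y` has degree two; the half-space has weight
  -- `r^n` and the divergence degree one. Both give `r^(n+1)`, hence the same radial integral.
  have hright : ∫ y : boundaryHyperplane (n + 1),
      (ψ (‖(y : EuclideanSpace ℝ (Fin (n + 1)))‖ ^ 2) • Y y) 0 =
      (integralHalfSphereBoundary (n + 1) fun τ ↦ Y τ 0) *
        ∫ r in Set.Ioi (0 : ℝ), r ^ (n + 1) * ψ (r ^ 2) := by
    have : Nontrivial (boundaryHyperplane (n + 1)) :=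
      Module.nontrivial_of_finrank_pos (R := ℝ) (by
        rw [finrank_boundaryHyperplane]; exact Nat.pos_of_ne_zero hn)
    have := integral_direction_mul_radial (volume : Measure (boundaryHyperplane (n + 1)))
      (fun y ↦ Y y 0) fun r ↦ r ^ 2 * ψ (r ^ 2)
    refine Eq.trans ?_ (this.trans ?_)
    · congr 1
      ext y
      rcases eq_or_ne y 0 with rfl | h0
      · simp [hψ0 0 one_pos]
      · have hyc : (y : EuclideanSpace ℝ (Fin (n + 1))) ∈ closedHalfSpace (n + 1) :=
          ⟨(show (y : EuclideanSpace ℝ (Fin (n + 1))) 0 = 0 from y.2).ge, by simpa using h0⟩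
        have hpos := norm_pos_iff.2 h0
        rw [Submodule.coe_smul, hYh _ (inv_pos.2 hpos) _ hyc]
        simp only [PiLp.smul_apply, smul_eq_mul, Submodule.coe_norm]
        rw [Submodule.coe_norm] at hpos
        field_simp
    · rw [integralHalfSphereBoundary, finrank_boundaryHyperplane]
      congr 1
      refine integral_congr_ae (Filter.Eventually.of_forall fun r ↦ ?_)
      -- The exponent `n - 1` is a truncated subtraction, harmless because `n ≠ 0`.
      obtain ⟨m, rfl⟩ := Nat.exists_eq_succ_of_ne_zero hn
      simp only [Nat.succ_eq_add_one, Nat.add_sub_cancel]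
      ring
  have hK : 0 < ∫ r in Set.Ioi (0 : ℝ), r ^ (n + 1) * ψ (r ^ 2) := by
    have hcont : Continuous fun r : ℝ ↦ r ^ (n + 1) * ψ (r ^ 2) :=
      (continuous_pow _).mul (ψ.continuous.comp (continuous_pow 2))
    have hcs : HasCompactSupport fun r : ℝ ↦ r ^ (n + 1) * ψ (r ^ 2) := by
      refine HasCompactSupport.intro (isCompact_Icc (a := (-2 : ℝ)) (b := 2)) fun r hr ↦ ?_
      rw [hψ3, mul_zero]
      by_contra! h
      exact hr ⟨by nlinarith, by nlinarith⟩
    rw [setIntegral_pos_iff_support_of_nonneg_ae]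
    · refine lt_of_lt_of_le ?_ (measure_mono (s := Set.Ioo (5 / 4 : ℝ) (3 / 2)) fun r hr ↦ ⟨?_, ?_⟩)
      · simp only [Real.volume_Ioo, ENNReal.ofReal_pos]; norm_num
      · have h0 : (0 : ℝ) < r := by linarith [hr.1]
        refine (mul_pos (pow_pos h0 _) (ψ.pos_of_mem_ball ?_)).ne'
        rw [Metric.mem_ball, Real.dist_eq, abs_lt]
        simp only [ψ]
        constructor <;> nlinarith [hr.1, hr.2]
      · exact Set.mem_Ioi.2 (by linarith [hr.1])
    · filter_upwards [ae_restrict_mem measurableSet_Ioi] with r hr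
      exact mul_nonneg (pow_nonneg (le_of_lt hr) _) ψ.nonneg
    · exact (hcont.integrable_of_hasCompactSupport hcs).integrableOn
  rw [hleft, hright, ← neg_mul] at key
  exact mul_right_cancel₀ hK.ne' key

/-! ### Pointwise divergences of the two fields. -/

section Divergence

variable {E : Type*} [NormedAddCommGroup E] [InnerProductSpace ℝ E]

/-- The divergence of a vector field at a point. -/
def divergence (V : E → E) (x : E) : ℝ :=
  LinearMap.trace ℝ E (fderiv ℝ V x : E →ₗ[ℝ] E)

theorem divergence_add {V W : E → E} {x : E} (hV : DifferentiableAt ℝ V x)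
    (hW : DifferentiableAt ℝ W x) :
    divergence (fun y ↦ V y + W y) x = divergence V x + divergence W x := by
  rw [divergence, fderiv_fun_add hV hW, ContinuousLinearMap.toLinearMap_add, map_add]
  rfl

theorem divergence_smul [FiniteDimensional ℝ E] {a : E → ℝ} {a' : E →L[ℝ] ℝ} {V : E → E} {x : E}
    (ha : HasFDerivAt a a' x) (hV : DifferentiableAt ℝ V x) :
    divergence (fun y ↦ a y • V y) x = a x * divergence V x + a' (V x) := by
  have h : HasFDerivAt (fun y ↦ a y • V y) (a x • fderiv ℝ V x + a'.smulRight (V x)) x :=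
    ha.smul hV.hasFDerivAt
  rw [divergence, h.fderiv, ContinuousLinearMap.toLinearMap_add,
    ContinuousLinearMap.toLinearMap_smul, map_add, map_smul, smul_eq_mul]
  congr 1
  exact LinearMap.trace_smulRight (a' : E →ₗ[ℝ] ℝ) (V x)

/-- The field `‖x‖² e - ⟪e, x⟫ x`, a multiple of the tangential part of `e`. -/
def tangentialPart (e x : E) : E := ‖x‖ ^ 2 • e - inner ℝ e x • x

theorem tangentialPart_smul (e x : E) (c : ℝ) :
    tangentialPart e (c • x) = c ^ 2 • tangentialPart e x := by
  simp only [tangentialPart, norm_smul, inner_smul_right, smul_sub, smul_smul, mul_pow,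
    Real.norm_eq_abs, sq_abs]
  congr 2
  ring

theorem inner_tangentialPart_self (e x : E) : inner ℝ x (tangentialPart e x) = 0 := by
  simp only [tangentialPart, inner_sub_right, inner_smul_right, real_inner_self_eq_norm_sq,
    real_inner_comm]
  ring

theorem hasFDerivAt_tangentialPart (e x : E) :
    HasFDerivAt (tangentialPart e) (((2 : ℕ) • innerSL ℝ x).smulRight e -
      (inner ℝ e x • ContinuousLinearMap.id ℝ E + (innerSL ℝ e).smulRight x)) x :=
  ((hasStrictFDerivAt_norm_sq x).hasFDerivAt.smul_const e).sub
    ((innerSL ℝ e).hasFDerivAt.smul (hasFDerivAt_id x))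

/-- On the unit sphere this is `Δ'φ = -(N-1)φ` for the linear function `φ = ⟨e, ·⟩`. -/
theorem divergence_tangentialPart [FiniteDimensional ℝ E] (e x : E) :
    divergence (tangentialPart e) x = (1 - Module.finrank ℝ E) * inner ℝ e x := by
  have h1 : LinearMap.trace ℝ E (((2 : ℕ) • innerSL ℝ x).smulRight e : E →L[ℝ] E) =
      2 * inner ℝ x e :=
    (LinearMap.trace_smulRight (((2 : ℕ) • innerSL ℝ x : E →L[ℝ] ℝ) : E →ₗ[ℝ] ℝ) e).trans (by simp)
  have h2 : LinearMap.trace ℝ E ((innerSL ℝ e).smulRight x : E →L[ℝ] E) = inner ℝ e x :=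
    LinearMap.trace_smulRight ((innerSL ℝ e : E →L[ℝ] ℝ) : E →ₗ[ℝ] ℝ) x
  have h3 : LinearMap.trace ℝ E (ContinuousLinearMap.id ℝ E : E →ₗ[ℝ] E) = Module.finrank ℝ E :=
    LinearMap.trace_id ℝ E
  rw [divergence, (hasFDerivAt_tangentialPart e x).fderiv, ContinuousLinearMap.toLinearMap_sub,
    ContinuousLinearMap.toLinearMap_add, ContinuousLinearMap.toLinearMap_smul, map_sub, map_add,
    map_smul, h1, h2, h3, real_inner_comm, smul_eq_mul]
  ring

/-- The vector field of the Pohozaev identity with multiplier `⟪∇u, e⟫`. -/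
def pohozaevField (e : E) (u : E → ℝ) (G : E → E) (F : ℝ → ℝ) (x : E) : E :=
  (‖x‖ ^ 4 * inner ℝ e (G x)) • G x +
    (F (u x) - 1 / 2 * (‖x‖ ^ 2 * ‖G x‖ ^ 2)) • tangentialPart e x

/-- The vector field of the energy identity with multiplier `⟪e, x⟫ u`. -/
def energyField (e : E) (u : E → ℝ) (G : E → E) (x : E) : E :=
  (‖x‖ ^ 2 * (inner ℝ e x * u x)) • G x + (-(1 / 2) * u x ^ 2) • tangentialPart e x

theorem hasFDerivAt_norm_pow_four (x : E) :
    HasFDerivAt (fun y : E ↦ ‖y‖ ^ 4) ((4 * ‖x‖ ^ 2) • innerSL ℝ x) x := by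
  have h := (hasStrictFDerivAt_norm_sq x).hasFDerivAt.pow 2
  refine (h.congr_fderiv ?_).congr_of_eventuallyEq (Filter.Eventually.of_forall fun y ↦ by ring)
  ext w
  simp
  ring

variable {e : E} {u : E → ℝ} {G : E → E} {H : E →L[ℝ] E} {F : ℝ → ℝ} {f : ℝ} {x : E}

theorem hasFDerivAt_pohozaevField_coeff_gradient (hG : HasFDerivAt G H x) :
    HasFDerivAt (fun y ↦ ‖y‖ ^ 4 * inner ℝ e (G y))
      (‖x‖ ^ 4 • (innerSL ℝ e ∘L H) + inner ℝ e (G x) • ((4 * ‖x‖ ^ 2) • innerSL ℝ x)) x :=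
  (hasFDerivAt_norm_pow_four x).mul ((innerSL ℝ e).hasFDerivAt.comp x hG)

theorem hasFDerivAt_pohozaevField_coeff_tangentialPart (hu : HasFDerivAt u (innerSL ℝ (G x)) x)
    (hG : HasFDerivAt G H x) (hF : HasDerivAt F f (u x)) :
    HasFDerivAt (fun y ↦ F (u y) - 1 / 2 * (‖y‖ ^ 2 * ‖G y‖ ^ 2))
      (f • innerSL ℝ (G x) - (1 / 2 : ℝ) • (‖x‖ ^ 2 • ((2 : ℕ) • (innerSL ℝ (G x)) ∘L H) +
        ‖G x‖ ^ 2 • ((2 : ℕ) • innerSL ℝ x))) x :=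
  (hF.comp_hasFDerivAt x hu).sub
    (((hasStrictFDerivAt_norm_sq x).hasFDerivAt.mul hG.norm_sq).const_mul (1 / 2))

theorem hasFDerivAt_energyField_coeff_gradient (hu : HasFDerivAt u (innerSL ℝ (G x)) x) :
    HasFDerivAt (fun y ↦ ‖y‖ ^ 2 * (inner ℝ e y * u y))
      (‖x‖ ^ 2 • (inner ℝ e x • innerSL ℝ (G x) + u x • innerSL ℝ e) +
        (inner ℝ e x * u x) • ((2 : ℕ) • innerSL ℝ x)) x :=
  (hasStrictFDerivAt_norm_sq x).hasFDerivAt.mul ((innerSL ℝ e).hasFDerivAt.mul hu)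

theorem hasFDerivAt_energyField_coeff_tangentialPart (hu : HasFDerivAt u (innerSL ℝ (G x)) x) :
    HasFDerivAt (fun y ↦ -(1 / 2) * u y ^ 2) (-u x • innerSL ℝ (G x)) x := by
  refine ((hu.pow 2).const_mul (-(1 / 2))).congr_fderiv ?_
  ext w
  simp
  ring

theorem differentiableAt_pohozaevField (hu : HasFDerivAt u (innerSL ℝ (G x)) x)
    (hG : HasFDerivAt G H x) (hF : HasDerivAt F f (u x)) :
    DifferentiableAt ℝ (pohozaevField e u G F) x :=
  ((hasFDerivAt_pohozaevField_coeff_gradient hG).differentiableAt.smul hG.differentiableAt).add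
    ((hasFDerivAt_pohozaevField_coeff_tangentialPart hu hG hF).differentiableAt.smul
      (hasFDerivAt_tangentialPart e x).differentiableAt)

theorem differentiableAt_energyField (hu : HasFDerivAt u (innerSL ℝ (G x)) x)
    (hG : HasFDerivAt G H x) : DifferentiableAt ℝ (energyField e u G) x :=
  ((hasFDerivAt_energyField_coeff_gradient hu).differentiableAt.smul hG.differentiableAt).add
    ((hasFDerivAt_energyField_coeff_tangentialPart hu).differentiableAt.smul
      (hasFDerivAt_tangentialPart e x).differentiableAt)

/-- Symmetry of the Hessian `H` cancels the second-order terms, and the equation cancels `f⟨e, G⟩`.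
The relation `H x = -G x` leaves `-⟨e, x⟩‖G‖²`, which turns the coefficient `(dim - 1)/2` into `(dim
- 3)/2`. Derivatives of powers of `‖x‖` drop out by tangentiality. -/
theorem divergence_pohozaevField [FiniteDimensional ℝ E]
    (hu : HasFDerivAt u (innerSL ℝ (G x)) x)
    (hG : HasFDerivAt G H x) (hF : HasDerivAt F f (u x))
    (hsymm : ∀ v w, inner ℝ (H v) w = inner ℝ v (H w)) (hHx : H x = -G x)
    (hGx : inner ℝ x (G x) = 0) (htr : divergence G x = -f) (hx : ‖x‖ = 1) :
    divergence (pohozaevField e u G F) x =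
      inner ℝ e x * (((Module.finrank ℝ E : ℝ) - 3) / 2 * ‖G x‖ ^ 2 -
        ((Module.finrank ℝ E : ℝ) - 1) * F (u x)) := by
  have ha := hasFDerivAt_pohozaevField_coeff_gradient (e := e) hG
  have hb := hasFDerivAt_pohozaevField_coeff_tangentialPart hu hG hF
  have hT := (hasFDerivAt_tangentialPart e x).differentiableAt
  have h1 : inner ℝ (G x) (H e) = inner ℝ e (H (G x)) := by rw [← hsymm, real_inner_comm]
  unfold pohozaevField
  rw [divergence_add (ha.differentiableAt.fun_smul hG.differentiableAt)
    (hb.differentiableAt.fun_smul hT), divergence_smul ha hG.differentiableAt,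
    divergence_smul hb hT, divergence_tangentialPart, htr]
  simp only [add_apply, sub_apply,
    smul_apply, ContinuousLinearMap.comp_apply, innerSL_apply_apply, hGx,
    inner_tangentialPart_self, smul_eq_mul, nsmul_eq_mul, hx]
  simp only [tangentialPart, map_sub, map_smul, hHx, inner_sub_right, inner_smul_right,
    inner_neg_right, real_inner_self_eq_norm_sq, h1, real_inner_comm x (G x), hGx,
    real_inner_comm e (G x), hx]
  push_cast
  ring

theorem divergence_energyField [FiniteDimensional ℝ E]
    (hu : HasFDerivAt u (innerSL ℝ (G x)) x)
    (hG : HasFDerivAt G H x) (hGx : inner ℝ x (G x) = 0) (htr : divergence G x = -f)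
    (hx : ‖x‖ = 1) :
    divergence (energyField e u G) x =
      inner ℝ e x * (‖G x‖ ^ 2 - u x * f + ((Module.finrank ℝ E : ℝ) - 1) / 2 * u x ^ 2) := by
  have ha := hasFDerivAt_energyField_coeff_gradient (e := e) hu
  have hb := hasFDerivAt_energyField_coeff_tangentialPart hu
  have hT := (hasFDerivAt_tangentialPart e x).differentiableAt
  unfold energyField
  rw [divergence_add (ha.differentiableAt.fun_smul hG.differentiableAt)
    (hb.differentiableAt.fun_smul hT), divergence_smul ha hG.differentiableAt,
    divergence_smul hb hT, divergence_tangentialPart, htr]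
  simp only [add_apply, smul_apply, innerSL_apply_apply,
    hGx, tangentialPart, inner_sub_right, inner_smul_right, real_inner_self_eq_norm_sq,
    real_inner_comm x (G x), real_inner_comm e (G x), smul_eq_mul, nsmul_eq_mul, hx]
  ring

theorem inner_pohozaevField_self (hGx : inner ℝ x (G x) = 0) :
    inner ℝ x (pohozaevField e u G F x) = 0 := by
  simp [pohozaevField, inner_add_right, inner_smul_right, hGx, inner_tangentialPart_self]

theorem inner_energyField_self (hGx : inner ℝ x (G x) = 0) :
    inner ℝ x (energyField e u G x) = 0 := by
  simp [energyField, inner_add_right, inner_smul_right, hGx, inner_tangentialPart_self]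

/-- The power `‖x‖ ^ 4` is chosen for this: `G` has degree `-1` and occurs twice, so the total
degree is two, that of `tangentialPart`. -/
theorem pohozaevField_smul {c : ℝ} (hc : 0 < c) (hu : u (c • x) = u x)
    (hG : G (c • x) = c⁻¹ • G x) :
    pohozaevField e u G F (c • x) = c ^ 2 • pohozaevField e u G F x := by
  have h1 : (‖c • x‖ ^ 4 * inner ℝ e (G (c • x))) • G (c • x) =
      c ^ 2 • (‖x‖ ^ 4 * inner ℝ e (G x)) • G x := by
    rw [hG, norm_smul, inner_smul_right, smul_smul, smul_smul, Real.norm_eq_abs, abs_of_pos hc]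
    congr 1
    field_simp
  have h2 : ‖c • x‖ ^ 2 * ‖G (c • x)‖ ^ 2 = ‖x‖ ^ 2 * ‖G x‖ ^ 2 := by
    rw [hG, norm_smul, norm_smul, Real.norm_eq_abs, Real.norm_eq_abs, abs_inv, abs_of_pos hc]
    field_simp
  rw [pohozaevField, pohozaevField, h1, h2, hu, tangentialPart_smul, smul_add, smul_comm (c ^ 2)
    (F (u x) - 1 / 2 * (‖x‖ ^ 2 * ‖G x‖ ^ 2))]

theorem energyField_smul {c : ℝ} (hc : 0 < c) (hu : u (c • x) = u x)
    (hG : G (c • x) = c⁻¹ • G x) :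
    energyField e u G (c • x) = c ^ 2 • energyField e u G x := by
  have h1 : (‖c • x‖ ^ 2 * (inner ℝ e (c • x) * u (c • x))) • G (c • x) =
      c ^ 2 • (‖x‖ ^ 2 * (inner ℝ e x * u x)) • G x := by
    rw [hG, hu, norm_smul, inner_smul_right, smul_smul, smul_smul, Real.norm_eq_abs, abs_of_pos hc]
    congr 1
    field_simp
  rw [energyField, energyField, h1, hu, tangentialPart_smul, smul_add, smul_comm (c ^ 2)
    (-(1 / 2) * u x ^ 2)]

theorem continuous_tangentialPart (e : E) : Continuous (tangentialPart e) := by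
  unfold tangentialPart
  fun_prop

theorem continuousOn_pohozaevField {s : Set E} (hu : ContinuousOn u s) (hG : ContinuousOn G s)
    (hF : Continuous F) : ContinuousOn (pohozaevField e u G F) s :=
  (((continuous_norm.pow 4).continuousOn.mul (continuousOn_const.inner hG)).smul hG).add
    (((hF.comp_continuousOn hu).sub (continuousOn_const.mul
      ((continuous_norm.pow 2).continuousOn.mul (hG.norm.pow 2)))).smul
        (continuous_tangentialPart e).continuousOn)

theorem continuousOn_energyField {s : Set E} (hu : ContinuousOn u s) (hG : ContinuousOn G s) :
    ContinuousOn (energyField e u G) s :=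
  (((continuous_norm.pow 2).continuousOn.mul
    ((continuousOn_const.inner continuousOn_id).mul hu)).smul hG).add
    ((continuousOn_const.mul (hu.pow 2)).smul (continuous_tangentialPart e).continuousOn)

end Divergence

/-! ### The gradient and Laplacian of the radial extension. -/

theorem radialExtension_smul {N : ℕ} (v : EuclideanSpace ℝ (Fin N) → ℝ) {c : ℝ} (hc : 0 < c)
    (x : EuclideanSpace ℝ (Fin N)) : radialExtension v (c • x) = radialExtension v x := by
  rw [radialExtension, radialExtension, norm_smul, smul_smul, Real.norm_eq_abs, abs_of_pos hc]
  congr 2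
  field_simp

theorem radialExtension_of_norm_eq_one {N : ℕ} (v : EuclideanSpace ℝ (Fin N) → ℝ)
    {x : EuclideanSpace ℝ (Fin N)} (hx : ‖x‖ = 1) : radialExtension v x = v x := by
  simp [radialExtension, hx]

open scoped Pointwise in
theorem smul_closedHalfSpace {N : ℕ} [NeZero N] {c : ℝ} (hc : 0 < c) :
    c • closedHalfSpace N = closedHalfSpace N := by
  ext x
  rw [Set.mem_smul_set_iff_inv_smul_mem₀ hc.ne']
  refine ⟨fun h ↦ ?_, fun h ↦ smul_mem_closedHalfSpace h (inv_pos.2 hc)⟩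
  simpa [smul_smul, hc.ne'] using smul_mem_closedHalfSpace h hc

theorem sphericalGradient_smul {N : ℕ} [NeZero N] (v : EuclideanSpace ℝ (Fin N) → ℝ) {c : ℝ}
    (hc : 0 < c) {x : EuclideanSpace ℝ (Fin N)} (hx : x ∈ closedHalfSpace N) :
    sphericalGradient v (c • x) = c⁻¹ • sphericalGradient v x := by
  have h : fderivWithin ℝ (radialExtension v) (closedHalfSpace N) x =
      c • fderivWithin ℝ (radialExtension v) (closedHalfSpace N) (c • x) := by
    have := fderivWithin_comp_smul (f := radialExtension v) c
      (uniqueDiffOn_closedHalfSpace N x hx)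
    rw [smul_closedHalfSpace hc] at this
    rw [← this]
    congr 1
    ext y
    exact (radialExtension_smul v hc y).symm
  rw [sphericalGradient, sphericalGradient, gradientWithin, gradientWithin, h, map_smul, smul_smul,
    inv_mul_cancel₀ hc.ne', one_smul]

theorem continuousOn_sphericalGradient {N : ℕ} [NeZero N] {v : EuclideanSpace ℝ (Fin N) → ℝ}
    (hv : ContDiffOn ℝ 1 (radialExtension v) (closedHalfSpace N)) :
    ContinuousOn (sphericalGradient v) (closedHalfSpace N) :=
  (InnerProductSpace.toDual ℝ _).symm.continuous.comp_continuousOn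
    (hv.continuousOn_fderivWithin (uniqueDiffOn_closedHalfSpace N) le_rfl)

theorem sphericalGradient_of_mem_openHalfSpace {N : ℕ} [NeZero N]
    (v : EuclideanSpace ℝ (Fin N) → ℝ) {x : EuclideanSpace ℝ (Fin N)}
    (hx : x ∈ openHalfSpace N) :
    sphericalGradient v x =
      (InnerProductSpace.toDual ℝ _).symm (fderiv ℝ (radialExtension v) x) := by
  rw [sphericalGradient, gradientWithin, fderivWithin_of_mem_nhds]
  exact Filter.mem_of_superset ((isOpen_openHalfSpace N).mem_nhds hx)
    (openHalfSpace_subset_closedHalfSpace N)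

theorem hasFDerivAt_radialExtension {N : ℕ} [NeZero N] {v : EuclideanSpace ℝ (Fin N) → ℝ}
    (hv : ContDiffOn ℝ 2 (radialExtension v) (openHalfSpace N)) {x : EuclideanSpace ℝ (Fin N)}
    (hx : x ∈ openHalfSpace N) :
    HasFDerivAt (radialExtension v) (innerSL ℝ (sphericalGradient v x)) x := by
  have h := (hv.contDiffAt ((isOpen_openHalfSpace N).mem_nhds hx)).differentiableAt (by norm_num)
  refine h.hasFDerivAt.congr_fderiv ?_
  ext w
  rw [sphericalGradient_of_mem_openHalfSpace v hx, innerSL_apply_apply,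
    InnerProductSpace.toDual_symm_apply]

/-- Euler's relation in degree zero: the extension is constant along rays. -/
theorem inner_sphericalGradient_self {N : ℕ} [NeZero N] {v : EuclideanSpace ℝ (Fin N) → ℝ}
    (hv : ContDiffOn ℝ 2 (radialExtension v) (openHalfSpace N)) {x : EuclideanSpace ℝ (Fin N)}
    (hx : x ∈ openHalfSpace N) : inner ℝ x (sphericalGradient v x) = 0 := by
  have hu := hasFDerivAt_radialExtension hv hx
  rw [← one_smul ℝ x] at hu
  have hd : HasDerivAt (fun t : ℝ ↦ radialExtension v (t • x))
      (inner ℝ (sphericalGradient v ((1 : ℝ) • x)) x) 1 := by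
    have hl : HasDerivAt (fun t : ℝ ↦ t • x) x 1 := by
      simpa using (hasDerivAt_id (1 : ℝ)).smul_const x
    have h := hu.comp_hasDerivAt (1 : ℝ) hl
    rwa [innerSL_apply_apply] at h
  have hc : HasDerivAt (fun t : ℝ ↦ radialExtension v (t • x)) 0 1 := by
    refine (hasDerivAt_const (1 : ℝ) (radialExtension v x)).congr_of_eventuallyEq ?_
    filter_upwards [lt_mem_nhds (zero_lt_one' ℝ)] with t ht
    exact radialExtension_smul v ht x
  rw [real_inner_comm]
  simpa using hd.unique hc

theorem hasFDerivAt_sphericalGradient {N : ℕ} [NeZero N] {v : EuclideanSpace ℝ (Fin N) → ℝ}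
    (hv : ContDiffOn ℝ 2 (radialExtension v) (openHalfSpace N)) {x : EuclideanSpace ℝ (Fin N)}
    (hx : x ∈ openHalfSpace N) :
    ∃ H : EuclideanSpace ℝ (Fin N) →L[ℝ] EuclideanSpace ℝ (Fin N),
      HasFDerivAt (sphericalGradient v) H x ∧
        ∀ w z, inner ℝ (H w) z = fderiv ℝ (fderiv ℝ (radialExtension v)) x w z := by
  have hc := hv.contDiffAt ((isOpen_openHalfSpace N).mem_nhds hx)
  have hd : DifferentiableAt ℝ (fderiv ℝ (radialExtension v)) x :=
    (hc.fderiv_right (m := 1) (by norm_num)).differentiableAt (by norm_num)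
  have h1 := ((InnerProductSpace.toDual ℝ
    (EuclideanSpace ℝ (Fin N))).symm.toContinuousLinearEquiv.hasFDerivAt).comp x hd.hasFDerivAt
  refine ⟨_, h1.congr_of_eventuallyEq ?_, fun w z ↦ ?_⟩
  · filter_upwards [(isOpen_openHalfSpace N).mem_nhds hx] with y hy
    exact sphericalGradient_of_mem_openHalfSpace v hy
  · exact InnerProductSpace.toDual_symm_apply

/-- Euler's relation for the gradient, which has degree `-1`. -/
theorem fderiv_sphericalGradient_self {N : ℕ} [NeZero N] {v : EuclideanSpace ℝ (Fin N) → ℝ}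
    {H : EuclideanSpace ℝ (Fin N) →L[ℝ] EuclideanSpace ℝ (Fin N)} {x : EuclideanSpace ℝ (Fin N)}
    (hx : x ∈ openHalfSpace N) (hH : HasFDerivAt (sphericalGradient v) H x) :
    H x = -sphericalGradient v x := by
  have hH' := hH
  rw [← one_smul ℝ x] at hH'
  have hd : HasDerivAt (fun t : ℝ ↦ sphericalGradient v (t • x)) (H x) 1 := by
    have hl : HasDerivAt (fun t : ℝ ↦ t • x) x 1 := by
      simpa using (hasDerivAt_id (1 : ℝ)).smul_const x
    exact hH'.comp_hasDerivAt (1 : ℝ) hl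
  have hc : HasDerivAt (fun t : ℝ ↦ sphericalGradient v (t • x)) (-sphericalGradient v x) 1 := by
    have hi : HasDerivAt (fun t : ℝ ↦ t⁻¹ • sphericalGradient v x) (-sphericalGradient v x) 1 := by
      simpa using (hasDerivAt_inv (one_ne_zero' ℝ)).smul_const (sphericalGradient v x)
    refine hi.congr_of_eventuallyEq ?_
    filter_upwards [lt_mem_nhds (zero_lt_one' ℝ)] with t ht
    exact sphericalGradient_smul v ht (openHalfSpace_subset_closedHalfSpace N hx)
  exact hd.unique hc

theorem divergence_sphericalGradient {N : ℕ} [NeZero N] {v : EuclideanSpace ℝ (Fin N) → ℝ}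
    (hv : ContDiffOn ℝ 2 (radialExtension v) (openHalfSpace N)) {x : EuclideanSpace ℝ (Fin N)}
    (hx : x ∈ openHalfSpace N) :
    divergence (sphericalGradient v) x = sphericalLaplacian v x := by
  obtain ⟨H, hH, hHv⟩ := hasFDerivAt_sphericalGradient hv hx
  rw [divergence, hH.fderiv, sphericalLaplacian,
    InnerProductSpace.laplacian_eq_iteratedFDeriv_orthonormalBasis _
      (EuclideanSpace.basisFun (Fin N) ℝ),
    LinearMap.trace_eq_sum_inner _ (EuclideanSpace.basisFun (Fin N) ℝ)]
  refine Finset.sum_congr rfl fun i _ ↦ ?_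
  rw [iteratedFDeriv_two_apply, real_inner_comm]
  exact hHv _ _

/-- If `v` vanishes on the boundary of the half-sphere, then its gradient is normal there. -/
theorem sphericalGradient_eq_of_boundary {N : ℕ} [NeZero N] {v : EuclideanSpace ℝ (Fin N) → ℝ}
    (hv : ContDiffOn ℝ 1 (radialExtension v) (closedHalfSpace N))
    (hb : ∀ σ : EuclideanSpace ℝ (Fin N), ‖σ‖ = 1 → σ 0 = 0 → v σ = 0)
    {x : EuclideanSpace ℝ (Fin N)} (hx : x ≠ 0) (hx0 : x 0 = 0) :
    sphericalGradient v x = EuclideanSpace.single 0 (sphericalGradient v x 0) := by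
  have hzero : ∀ y : EuclideanSpace ℝ (Fin N), y ≠ 0 → y 0 = 0 → radialExtension v y = 0 :=
    fun y hy hy0 ↦ hb _ (by rw [norm_smul, norm_inv, norm_norm,
      inv_mul_cancel₀ (norm_ne_zero_iff.2 hy)]) (by simp [hy0])
  have hd := ((hv.differentiableOn (by norm_num)) x ⟨hx0.ge, hx⟩).hasFDerivWithinAt
  ext i
  rcases eq_or_ne i 0 with rfl | hi
  · simp
  have hw0 : (EuclideanSpace.single i (1 : ℝ) : EuclideanSpace ℝ (Fin N)) 0 = 0 := by
    simp [hi.symm]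
  set w : EuclideanSpace ℝ (Fin N) := EuclideanSpace.single i 1 with hw
  have hl : HasDerivAt (fun t : ℝ ↦ x + t • w) w 0 := by
    simpa using ((hasDerivAt_id (0 : ℝ)).smul_const w).const_add x
  have hne : ∀ᶠ t : ℝ in nhds 0, x + t • w ≠ 0 :=
    hl.continuousAt.eventually_ne (by simpa using hx)
  -- The line in the tangential direction `w` stays in the hyperplane, hence in the closed
  -- half-space away from the origin. As `s` is a neighbourhood of `0`, the derivative within it is
  -- a two-sided one.
  set s : Set ℝ := {t | x + t • w ≠ 0} with hs
  have hmem : s ∈ nhds (0 : ℝ) := hne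
  have h0 : x + (0 : ℝ) • w = x := by simp
  have h1 : HasDerivWithinAt (fun t : ℝ ↦ radialExtension v (x + t • w))
      (fderivWithin ℝ (radialExtension v) (closedHalfSpace N) x w) s 0 := by
    rw [← h0] at hd
    have hmaps : Set.MapsTo (fun t : ℝ ↦ x + t • w) s (closedHalfSpace N) :=
      fun t ht ↦ ⟨by simp [hx0, hw0], ht⟩
    have := hd.comp_hasDerivWithinAt (0 : ℝ) hl.hasDerivWithinAt hmaps
    rwa [h0] at this
  have h2 : HasDerivAt (fun t : ℝ ↦ radialExtension v (x + t • w)) 0 0 := by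
    refine (hasDerivAt_const (0 : ℝ) (0 : ℝ)).congr_of_eventuallyEq ?_
    filter_upwards [hne] with t ht
    exact hzero _ ht (by simp [hx0, hw0])
  have h3 := (h1.hasDerivAt hmem).unique h2
  have h4 : inner ℝ (sphericalGradient v x) w = 0 := by
    rw [sphericalGradient, gradientWithin, InnerProductSpace.toDual_symm_apply, h3]
  rw [hw, EuclideanSpace.inner_single_right] at h4
  simpa [hi] using h4

/-! ### The nonlinearity and integrals over the half-sphere. -/

/-- Valid for every real `t` under the convention of `Real.rpow` at negative bases, so no sign of
`v` is needed. The form `t * t ^ q` matches the product of `v` and `v ^ q` in the energy identity.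
-/
theorem hasDerivAt_mul_rpow_self {q : ℝ} (hq : 1 < q) (t : ℝ) :
    HasDerivAt (fun t : ℝ ↦ t * t ^ q) ((q + 1) * t ^ q) t := by
  have h := (hasDerivAt_id t).mul (Real.hasDerivAt_rpow_const (x := t) (p := q) (Or.inr hq.le))
  refine h.congr_deriv ?_
  rcases eq_or_ne t 0 with rfl | ht
  · simp [Real.zero_rpow (by linarith : q ≠ 0)]
  · rw [Real.rpow_sub_one ht]
    simp only [id]
    field_simp
    ring

theorem hasDerivAt_nonlinearity_primitive {q : ℝ} (hq : 1 < q) (lam t : ℝ) :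
    HasDerivAt (fun t : ℝ ↦ lam / 2 * t ^ 2 + 1 / (q + 1) * (t * t ^ q)) (lam * t + t ^ q) t := by
  have h := ((hasDerivAt_pow 2 t).const_mul (lam / 2)).add
    ((hasDerivAt_mul_rpow_self hq t).const_mul (1 / (q + 1)))
  refine h.congr_deriv ?_
  have : q + 1 ≠ 0 := by linarith
  field_simp
  simp
  ring

theorem integrableOn_halfSphere {N : ℕ} [NeZero N] {h : EuclideanSpace ℝ (Fin N) → ℝ}
    (hh : ContinuousOn h (closedHalfSpace N)) :
    IntegrableOn (fun σ : Metric.sphere (0 : EuclideanSpace ℝ (Fin N)) 1 ↦ h σ)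
      {σ | 0 < (σ : EuclideanSpace ℝ (Fin N)) 0}
      (volume : Measure (EuclideanSpace ℝ (Fin N))).toSphere := by
  have hcont : Continuous fun σ : Metric.sphere (0 : EuclideanSpace ℝ (Fin N)) 1 ↦
      (σ : EuclideanSpace ℝ (Fin N)) 0 :=
    (EuclideanSpace.proj (𝕜 := ℝ) (0 : Fin N)).continuous.comp continuous_subtype_val
  have hK : IsCompact {σ : Metric.sphere (0 : EuclideanSpace ℝ (Fin N)) 1 |
      0 ≤ (σ : EuclideanSpace ℝ (Fin N)) 0} := (isClosed_le continuous_const hcont).isCompact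
  refine (ContinuousOn.integrableOn_compact hK (hh.comp continuous_subtype_val.continuousOn
    fun σ hσ ↦ ⟨hσ, ne_zero_of_mem_unit_sphere σ⟩)).mono_set fun σ hσ ↦ ?_
  exact le_of_lt (show 0 < (σ : EuclideanSpace ℝ (Fin N)) 0 from hσ)

theorem integralHalfSphere_linear_combination {N : ℕ} [NeZero N]
    {h₁ h₂ h₃ : EuclideanSpace ℝ (Fin N) → ℝ} (H₁ : ContinuousOn h₁ (closedHalfSpace N))
    (H₂ : ContinuousOn h₂ (closedHalfSpace N)) (H₃ : ContinuousOn h₃ (closedHalfSpace N))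
    (a b c : ℝ) :
    integralHalfSphere N (fun x ↦ a * h₁ x + b * h₂ x + c * h₃ x) =
      a * integralHalfSphere N h₁ + b * integralHalfSphere N h₂ +
        c * integralHalfSphere N h₃ := by
  have I₁ := (integrableOn_halfSphere H₁).const_mul a
  have I₂ := (integrableOn_halfSphere H₂).const_mul b
  have I₃ := (integrableOn_halfSphere H₃).const_mul c
  unfold integralHalfSphere
  refine (integral_add (I₁.add I₂) I₃).trans ?_
  rw [integral_add' I₁ I₂, integral_const_mul, integral_const_mul, integral_const_mul]

theorem integralHalfSphere_radialExtension {N : ℕ} [NeZero N]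
    (v : EuclideanSpace ℝ (Fin N) → ℝ) (f : ℝ → EuclideanSpace ℝ (Fin N) → ℝ) :
    integralHalfSphere N (fun x ↦ f (radialExtension v x) x) =
      integralHalfSphere N fun x ↦ f (v x) x := by
  unfold integralHalfSphere
  congr 1
  ext σ
  beta_reduce
  rw [radialExtension_of_norm_eq_one v (norm_eq_of_mem_sphere σ)]

/-! ### The Pohozaev and energy identities. -/

section Solution

variable {n : ℕ} {lam q : ℝ} {v : EuclideanSpace ℝ (Fin (n + 1)) → ℝ}

theorem inner_single_zero_one (x : EuclideanSpace ℝ (Fin (n + 1))) :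
    inner ℝ (EuclideanSpace.single 0 (1 : ℝ)) x = x 0 := by
  simp [EuclideanSpace.inner_single_left]

theorem continuous_mul_rpow_self (hq : 1 < q) : Continuous fun t : ℝ ↦ t * t ^ q :=
  continuous_id.mul (Real.continuous_rpow_const (by linarith))

theorem continuousOn_coordinate_zero (s : Set (EuclideanSpace ℝ (Fin (n + 1)))) :
    ContinuousOn (fun x : EuclideanSpace ℝ (Fin (n + 1)) ↦ x 0) s :=
  (EuclideanSpace.proj (𝕜 := ℝ) (0 : Fin (n + 1))).continuous.continuousOn

theorem IsHalfSphereSolution.divergence_sphericalGradient_eq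
    (hv : IsHalfSphereSolution (n + 1) lam q v) {x : EuclideanSpace ℝ (Fin (n + 1))}
    (hx : x ∈ openHalfSpace (n + 1)) (hx1 : ‖x‖ = 1) :
    divergence (sphericalGradient v) x =
      -(lam * radialExtension v x + radialExtension v x ^ q) := by
  rw [divergence_sphericalGradient hv.contDiff_inside hx, radialExtension_of_norm_eq_one v hx1,
    ← hv.equation x hx1 hx, neg_neg]

theorem IsHalfSphereSolution.pohozaev_identity (hn : n ≠ 0) (hq : 1 < q)
    (hv : IsHalfSphereSolution (n + 1) lam q v) :
    ((n : ℝ) - 2) / 2 *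
        integralHalfSphere (n + 1) (fun σ ↦ ‖sphericalGradient v σ‖ ^ 2 * σ 0) -
      n * (lam / 2 * integralHalfSphere (n + 1) (fun σ ↦ v σ ^ 2 * σ 0) +
        1 / (q + 1) * integralHalfSphere (n + 1) (fun σ ↦ v σ * v σ ^ q * σ 0)) =
      -(1 / 2 * integralHalfSphereBoundary (n + 1) fun τ ↦ ‖sphericalGradient v τ‖ ^ 2) := by
  set u := radialExtension v with hu
  set G := sphericalGradient v with hG
  set F : ℝ → ℝ := fun t ↦ lam / 2 * t ^ 2 + 1 / (q + 1) * (t * t ^ q) with hF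
  have huc : ContinuousOn u (closedHalfSpace (n + 1)) := hv.contDiff_upToBoundary.continuousOn
  have hGc : ContinuousOn G (closedHalfSpace (n + 1)) :=
    continuousOn_sphericalGradient hv.contDiff_upToBoundary
  have hc0 := continuousOn_coordinate_zero (closedHalfSpace (n + 1))
  have hFc : Continuous F := (continuous_const.mul (continuous_pow 2)).add
    (continuous_const.mul (continuous_mul_rpow_self hq))
  have h₁ : ContinuousOn (fun x ↦ ‖G x‖ ^ 2 * x 0) (closedHalfSpace (n + 1)) :=
    (hGc.norm.pow 2).mul hc0
  have h₂ : ContinuousOn (fun x ↦ u x ^ 2 * x 0) (closedHalfSpace (n + 1)) := (huc.pow 2).mul hc0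
  have h₃ : ContinuousOn (fun x ↦ u x * u x ^ q * x 0) (closedHalfSpace (n + 1)) :=
    ((continuous_mul_rpow_self hq).comp_continuousOn huc).mul hc0
  have hcomb : ContinuousOn (fun x ↦ ((n : ℝ) - 2) / 2 * (‖G x‖ ^ 2 * x 0) +
      -(n * (lam / 2)) * (u x ^ 2 * x 0) + -(n * (1 / (q + 1))) * (u x * u x ^ q * x 0))
      (closedHalfSpace (n + 1)) :=
    ((continuousOn_const.mul h₁).add (continuousOn_const.mul h₂)).add (continuousOn_const.mul h₃)
  have key := integralHalfSphere_divergence n hn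
    (pohozaevField (EuclideanSpace.single 0 1) u G F) _
    (continuousOn_pohozaevField huc hGc hFc)
    (fun c hc x hx ↦ pohozaevField_smul hc (radialExtension_smul v hc x)
      (sphericalGradient_smul v hc hx))
    (fun x hx ↦ by
      obtain ⟨H, hH, -⟩ := hasFDerivAt_sphericalGradient hv.contDiff_inside hx
      exact differentiableAt_pohozaevField (hasFDerivAt_radialExtension hv.contDiff_inside hx) hH
        (hasDerivAt_nonlinearity_primitive hq lam _))
    (fun x hx ↦ inner_pohozaevField_self (inner_sphericalGradient_self hv.contDiff_inside hx))
    hcomb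
    (fun x hx hx1 ↦ by
      obtain ⟨H, hH, hHv⟩ := hasFDerivAt_sphericalGradient hv.contDiff_inside hx
      have hs : IsSymmSndFDerivAt ℝ u x :=
        (hv.contDiff_inside.contDiffAt ((isOpen_openHalfSpace _).mem_nhds hx)).isSymmSndFDerivAt
          (by simp)
      have h := divergence_pohozaevField (e := EuclideanSpace.single 0 1)
        (hasFDerivAt_radialExtension hv.contDiff_inside hx) hH
        (hasDerivAt_nonlinearity_primitive hq lam _)
        (fun w z ↦ by rw [hHv, real_inner_comm, hHv]; exact hs w z)
        (fderiv_sphericalGradient_self hx hH)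
        (inner_sphericalGradient_self hv.contDiff_inside hx)
        (hv.divergence_sphericalGradient_eq hx hx1) hx1
      rw [inner_single_zero_one, finrank_euclideanSpace_fin] at h
      refine h.trans ?_
      push_cast
      ring)
  -- At the boundary `F(u) = 0` and `G = G₀ e`, so the first component is `G₀² - G₀²/2`.
  have hright : (integralHalfSphereBoundary (n + 1) fun τ ↦
      pohozaevField (EuclideanSpace.single 0 1) u G F τ 0) =
      1 / 2 * integralHalfSphereBoundary (n + 1) fun τ ↦ ‖G τ‖ ^ 2 := by
    rw [integralHalfSphereBoundary, integralHalfSphereBoundary, ← integral_const_mul]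
    congr 1
    ext τ
    set x : EuclideanSpace ℝ (Fin (n + 1)) := ((τ : boundaryHyperplane (n + 1)) :
      EuclideanSpace ℝ (Fin (n + 1))) with hx
    have hx0 : x 0 = 0 := (τ : boundaryHyperplane (n + 1)).2
    have hx1 : ‖x‖ = 1 := norm_eq_of_mem_sphere τ
    have hGx := sphericalGradient_eq_of_boundary hv.contDiff_upToBoundary hv.boundary
      (norm_ne_zero_iff.1 (by rw [hx1]; exact one_ne_zero)) hx0
    have hnorm : ‖G x‖ ^ 2 = G x 0 ^ 2 := by
      rw [hG, hGx]
      simp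
    have hux : u x = 0 := by rw [hu, radialExtension_of_norm_eq_one v hx1, hv.boundary x hx1 hx0]
    simp only [pohozaevField, tangentialPart, inner_single_zero_one, PiLp.add_apply,
      PiLp.smul_apply, PiLp.sub_apply, hx0, hx1, hux, hF, hnorm, smul_eq_mul,
      PiLp.single_apply]
    simp
    ring
  rw [hright, integralHalfSphere_linear_combination h₁ h₂ h₃, hu,
    integralHalfSphere_radialExtension v fun t x ↦ t ^ 2 * x 0,
    integralHalfSphere_radialExtension v fun t x ↦ t * t ^ q * x 0] at key
  linarith

theorem IsHalfSphereSolution.energy_identity (hn : n ≠ 0) (hq : 1 < q)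
    (hv : IsHalfSphereSolution (n + 1) lam q v) :
    integralHalfSphere (n + 1) (fun σ ↦ ‖sphericalGradient v σ‖ ^ 2 * σ 0) +
      (n / 2 - lam) * integralHalfSphere (n + 1) (fun σ ↦ v σ ^ 2 * σ 0) -
        integralHalfSphere (n + 1) (fun σ ↦ v σ * v σ ^ q * σ 0) = 0 := by
  set u := radialExtension v with hu
  set G := sphericalGradient v with hG
  have huc : ContinuousOn u (closedHalfSpace (n + 1)) := hv.contDiff_upToBoundary.continuousOn
  have hGc : ContinuousOn G (closedHalfSpace (n + 1)) :=
    continuousOn_sphericalGradient hv.contDiff_upToBoundary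
  have hc0 := continuousOn_coordinate_zero (closedHalfSpace (n + 1))
  have h₁ : ContinuousOn (fun x ↦ ‖G x‖ ^ 2 * x 0) (closedHalfSpace (n + 1)) :=
    (hGc.norm.pow 2).mul hc0
  have h₂ : ContinuousOn (fun x ↦ u x ^ 2 * x 0) (closedHalfSpace (n + 1)) := (huc.pow 2).mul hc0
  have h₃ : ContinuousOn (fun x ↦ u x * u x ^ q * x 0) (closedHalfSpace (n + 1)) :=
    ((continuous_mul_rpow_self hq).comp_continuousOn huc).mul hc0
  have hcomb : ContinuousOn (fun x ↦ 1 * (‖G x‖ ^ 2 * x 0) + (n / 2 - lam) * (u x ^ 2 * x 0) +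
      -1 * (u x * u x ^ q * x 0)) (closedHalfSpace (n + 1)) :=
    ((continuousOn_const.mul h₁).add (continuousOn_const.mul h₂)).add (continuousOn_const.mul h₃)
  have key := integralHalfSphere_divergence n hn
    (energyField (EuclideanSpace.single 0 1) u G) _
    (continuousOn_energyField huc hGc)
    (fun c hc x hx ↦ energyField_smul hc (radialExtension_smul v hc x)
      (sphericalGradient_smul v hc hx))
    (fun x hx ↦ by
      obtain ⟨H, hH, -⟩ := hasFDerivAt_sphericalGradient hv.contDiff_inside hx
      exact differentiableAt_energyField (hasFDerivAt_radialExtension hv.contDiff_inside hx) hH)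
    (fun x hx ↦ inner_energyField_self (inner_sphericalGradient_self hv.contDiff_inside hx))
    hcomb
    (fun x hx hx1 ↦ by
      obtain ⟨H, hH, -⟩ := hasFDerivAt_sphericalGradient hv.contDiff_inside hx
      have h := divergence_energyField (e := EuclideanSpace.single 0 1)
        (hasFDerivAt_radialExtension hv.contDiff_inside hx) hH
        (inner_sphericalGradient_self hv.contDiff_inside hx)
        (hv.divergence_sphericalGradient_eq hx hx1) hx1
      rw [inner_single_zero_one, finrank_euclideanSpace_fin] at h
      refine h.trans ?_
      push_cast
      ring)
  have hright : (integralHalfSphereBoundary (n + 1) fun τ ↦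
      energyField (EuclideanSpace.single 0 1) u G τ 0) = 0 := by
    rw [integralHalfSphereBoundary]
    refine integral_eq_zero_of_ae (Filter.Eventually.of_forall fun τ ↦ ?_)
    have hx0 : ((τ : boundaryHyperplane (n + 1)) : EuclideanSpace ℝ (Fin (n + 1))) 0 = 0 :=
      (τ : boundaryHyperplane (n + 1)).2
    have hx1 : ‖((τ : boundaryHyperplane (n + 1)) : EuclideanSpace ℝ (Fin (n + 1)))‖ = 1 :=
      norm_eq_of_mem_sphere τ
    have hux : u ((τ : boundaryHyperplane (n + 1)) : EuclideanSpace ℝ (Fin (n + 1))) = 0 := by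
      rw [hu, radialExtension_of_norm_eq_one v hx1, hv.boundary _ hx1 hx0]
    simp [energyField, hux]
  rw [hright, integralHalfSphere_linear_combination h₁ h₂ h₃, hu,
    integralHalfSphere_radialExtension v fun t x ↦ t ^ 2 * x 0,
    integralHalfSphere_radialExtension v fun t x ↦ t * t ^ q * x 0] at key
  linarith

end Solution

end

/-! ### Elimination of the integral of the nonlinear term. -/

theorem mainTheorem5 (N : ℕ) [NeZero N] (hN : 4 ≤ N) (q lam : ℝ) (hq : 1 < q)
    (v : EuclideanSpace ℝ (Fin N) → ℝ) (hv : IsHalfSphereSolution N lam q v) :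
    ((N : ℝ) - 3) / (q + 1) * (q - criticalExponentThree N) *
        integralHalfSphere N (fun σ => ‖sphericalGradient v σ‖ ^ 2 * σ 0)
      - ((N : ℝ) - 1) * (q - 1) / (q + 1) * (lam + ((N : ℝ) - 1) / (q - 1)) *
        integralHalfSphere N (fun σ => v σ ^ 2 * σ 0)
      = -integralHalfSphereBoundary N (fun τ => ‖sphericalGradient v τ‖ ^ 2) := by
  obtain ⟨n, rfl⟩ : ∃ n, N = n + 1 := ⟨N - 1, by omega⟩
  have h1 := hv.pohozaev_identity (by omega) hq
  have h2 := hv.energy_identity (by omega) hq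
  have hn : (3 : ℝ) ≤ n := by exact_mod_cast (by omega : 3 ≤ n)
  set A := integralHalfSphere (n + 1) (fun σ => ‖sphericalGradient v σ‖ ^ 2 * σ 0)
  set B := integralHalfSphere (n + 1) (fun σ => v σ ^ 2 * σ 0)
  set C := integralHalfSphere (n + 1) (fun σ => v σ * v σ ^ q * σ 0)
  set D := integralHalfSphereBoundary (n + 1) fun τ ↦ ‖sphericalGradient v τ‖ ^ 2
  have hC : C = A + (n / 2 - lam) * B := by linarith
  have hD : -D = (n - 2) * A - 2 * n * (lam / 2 * B + 1 / (q + 1) * C) := by linarith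
  have hq1 : q - 1 ≠ 0 := by linarith
  have hq2 : q + 1 ≠ 0 := by linarith
  -- `N - 3` is the denominator of the critical exponent; this is where `N ≥ 4` matters.
  have hn2 : (n : ℝ) + 1 - 3 ≠ 0 := by linarith
  rw [hD, hC, criticalExponentThree]
  push_cast
  field_simp
  ring
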